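/- Let $\Sigma$ be a finite alphabet and let $X \subseteq \Sigma^{\mathbb{Z}^2}$ be a non-empty two-dimensional subshift, i.e. a non-empty set of configurations $x : \mathbb{Z}^2 \to \Sigma$ that is closed in the product topology ($\Sigma$ being discrete) and invariant under all shifts $\sigma_v$, $(\sigma_v x)_z = x_{z+v}$, $v \in \mathbb{Z}^2$. Number the letters of $\Sigma$ by distinct natural numbers in any way and list $\mathbb{Z}^2$ by the standard computable bijection with $\mathbb{N}$, so that each configuration is coded by a function $\mathbb{N} \to \mathbb{N}$; a configuration is called computable if its code is a computable function, and its Turing degree is the Turing degree of its code (neither notion depends on the numbering of the letters). If no point of $X$ is computable, then $X$ contains two points $x, y$ whose Turing degrees are different but comparable: $\deg_T x \neq \deg_T y$, and $\deg_T x \leq \deg_T y$ or $\deg_T y \leq \deg_T x$. -/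

import Mathlib

namespace PlaneConfig

/-- The infinite sequence of natural numbers that codes a configuration `x : ℤ × ℤ → A` on a
finite alphabet: the `n`-th term is the code (an arbitrary injective numbering of the letters) of
the letter of `x` at the `n`-th cell of the plane, cells being listed by the standard computable
bijection `ℕ ≃ ℤ × ℤ`. -/
def code {A : Type*} [Encodable A] (x : ℤ × ℤ → A) : ℕ → ℕ :=
  fun n => Encodable.encode (x (Denumerable.ofNat (ℤ × ℤ) n))

/-- A configuration is computable if the sequence coding it is a computable function. -/
def IsComputable {A : Type*} [Encodable A] (x : ℤ × ℤ → A) : Prop :=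
  Computable (code x)

/-- The Turing degree of a configuration is the Turing degree of the (total) sequence coding it. -/
def degree {A : Type*} [Encodable A] (x : ℤ × ℤ → A) : TuringDegree :=
  toAntisymmetrization TuringReducible (code x : ℕ →. ℕ)

/-- The order of Turing degrees, on degrees of configurations, is relative computability. -/
theorem degree_le_degree_iff {A : Type*} [Encodable A] {x y : ℤ × ℤ → A} :
    degree x ≤ degree y ↔ ComputableIn {(code y : ℕ →. ℕ)} (code x) :=
  Iff.rfl

end PlaneConfig

/-! By compactness `X` contains a minimal subshift `M`. A point of `M` that is isolated in its own
orbit has a finite orbit, hence two independent periods, hence is computable. With no computable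
points, every initial segment of every point of `M` therefore recurs at a translate that differs
from the point.

This recurrence codes an arbitrary bit sequence `d` into a point of `M`. Given a prefix, extend it
to the lexicographically largest or smallest point of `M` with that prefix, according to the next
bit. Translates that agree with the prefix compete in this extremum, so at the first disagreement
every one of them lies on the same side, and the side spells the bit. A search for the first such
return recovers both the bit and the length of the next prefix, so the limit point computes `d`
(`exists_extension`, `exists_mem_recursiveIn`).

Now take `x` in `M`, a sequence `d` strictly above `x` (`exists_strictly_above`), and `y` in `M`
that computes `d`: then `y` is strictly above `x`. -/

namespace Nat.RecursiveIn

/-! ### Relative computability and a strictly higher degree -/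

variable {O : Set (ℕ →. ℕ)} {f g : ℕ → ℕ}

theorem of_primrec (hf : Primrec f) : Nat.RecursiveIn O (f : ℕ →. ℕ) :=
  (Primrec.nat_iff.1 hf).recursiveIn

theorem comp_total (hf : Nat.RecursiveIn O (f : ℕ →. ℕ)) (hg : Nat.RecursiveIn O (g : ℕ →. ℕ)) :
    Nat.RecursiveIn O ((fun n => f (g n) : ℕ → ℕ) : ℕ →. ℕ) :=
  (hf.comp hg).of_eq fun n => Part.bind_some (g n) (f : ℕ →. ℕ)

theorem pair_total (hf : Nat.RecursiveIn O (f : ℕ →. ℕ)) (hg : Nat.RecursiveIn O (g : ℕ →. ℕ)) :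
    Nat.RecursiveIn O ((fun n => Nat.pair (f n) (g n) : ℕ → ℕ) : ℕ →. ℕ) :=
  (hf.pair hg).of_eq fun n => by simp [Seq.seq]

theorem comp₂_total {h : ℕ → ℕ → ℕ} (hh : Primrec₂ h) (hf : Nat.RecursiveIn O (f : ℕ →. ℕ))
    (hg : Nat.RecursiveIn O (g : ℕ →. ℕ)) :
    Nat.RecursiveIn O ((fun n => h (f n) (g n) : ℕ → ℕ) : ℕ →. ℕ) :=
  ((of_primrec (f := fun p => h p.unpair.1 p.unpair.2)
    (hh.comp (Primrec.fst.comp Primrec.unpair) (Primrec.snd.comp Primrec.unpair))).comp_total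
      (hf.pair_total hg)).of_eq fun n => by simp

/-- Primitive recursion without parameters. -/
theorem of_rec {h : ℕ → ℕ → ℕ}
    (hh : Nat.RecursiveIn O ((fun p => h p.unpair.1 p.unpair.2 : ℕ → ℕ) : ℕ →. ℕ))
    (hs : ∀ k, g (k + 1) = h k (g k)) :
    Nat.RecursiveIn O (g : ℕ →. ℕ) := by
  have hbase : Nat.RecursiveIn O ((fun _ => g 0 : ℕ → ℕ) : ℕ →. ℕ) :=
    of_primrec (_root_.Primrec.const (g 0))
  have hstep : Nat.RecursiveIn O
      ((fun p => h p.unpair.2.unpair.1 p.unpair.2.unpair.2 : ℕ → ℕ) : ℕ →. ℕ) :=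
    hh.comp_total (of_primrec (Primrec.snd.comp Primrec.unpair))
  have hin : Nat.RecursiveIn O ((fun n => Nat.pair 0 n : ℕ → ℕ) : ℕ →. ℕ) :=
    (of_primrec (_root_.Primrec.const 0)).pair_total (of_primrec _root_.Primrec.id)
  refine ((hbase.prec hstep).comp hin).of_eq fun n => ?_
  simp only [PFun.coe_val, Part.bind_eq_bind, Part.bind_some, Nat.unpair_pair]
  induction n with
  | zero => simp
  | succ k ih => simp only [ih]; simp [hs]

/-- Unbounded search for a witness of a relation decided by a function recursive in the
oracles. -/
theorem of_isLeast {q : ℕ → ℕ → ℕ}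
    (hq : Nat.RecursiveIn O ((fun p => q p.unpair.1 p.unpair.2 : ℕ → ℕ) : ℕ →. ℕ))
    (hg : ∀ a, IsLeast {t | q a t = 0} (g a)) : Nat.RecursiveIn O (g : ℕ →. ℕ) := by
  refine hq.rfind.of_eq_tot fun a => ?_
  refine Nat.mem_rfind.2 ?_
  refine ⟨by simpa using (hg a).1, fun {m} hm => ?_⟩
  have : q a m ≠ 0 := fun h => absurd ((hg a).2 h) (not_le.2 hm)
  simpa using this

/-- Only countably many partial functions are recursive in a countable set of oracles. -/
theorem countable_setOf (hO : O.Countable) : {f : ℕ →. ℕ | Nat.RecursiveIn O f}.Countable := by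
  let pairing : (ℕ →. ℕ) → (ℕ →. ℕ) → (ℕ →. ℕ) := fun f h n => Nat.pair <$> f n <*> h n
  let composing : (ℕ →. ℕ) → (ℕ →. ℕ) → (ℕ →. ℕ) := fun f h n => h n >>= f
  let recursion : (ℕ →. ℕ) → (ℕ →. ℕ) → (ℕ →. ℕ) := fun f h p =>
    let (a, n) := Nat.unpair p
    n.rec (f a) fun y IH => do
      let i ← IH
      h (Nat.pair a (Nat.pair y i))
  let search : (ℕ →. ℕ) → (ℕ →. ℕ) := fun f a =>
    Nat.rfind fun n => (fun m => m = 0) <$> f (Nat.pair a n)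
  let basic : Set (ℕ →. ℕ) := {fun _ => 0, (Nat.succ : ℕ →. ℕ),
    ((fun n => (Nat.unpair n).1 : ℕ → ℕ) : ℕ →. ℕ), ((fun n => (Nat.unpair n).2 : ℕ → ℕ) : ℕ →. ℕ)}
  -- Stage `k` holds the functions built from the basic ones and the oracles by at most `k` nested
  -- operations; each stage is countable.
  let S : ℕ → Set (ℕ →. ℕ) := fun k => Nat.rec (basic ∪ O) (fun _ T =>
    T ∪ Set.image2 pairing T T ∪ Set.image2 composing T T ∪ Set.image2 recursion T T ∪
      search '' T) k
  have hS : ∀ k, S (k + 1) = S k ∪ Set.image2 pairing (S k) (S k) ∪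
      Set.image2 composing (S k) (S k) ∪ Set.image2 recursion (S k) (S k) ∪ search '' S k :=
    fun _ => rfl
  have hcount : ∀ k, (S k).Countable := by
    intro k
    induction k with
    | zero =>
      refine Set.Countable.union (Set.Finite.countable ?_) hO
      exact ((((Set.finite_singleton _).insert _).insert _).insert _)
    | succ k ih =>
      rw [hS]
      exact ((((ih.union (ih.image2 ih _)).union (ih.image2 ih _)).union (ih.image2 ih _)).union
        (ih.image _))
  have hmono : Monotone S := monotone_nat_of_le_succ fun k => by
    rw [hS]
    intro f hf
    exact Or.inl (Or.inl (Or.inl (Or.inl hf)))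
  refine (Set.countable_iUnion hcount).mono fun f hf => ?_
  rw [Set.mem_iUnion]
  replace hf : Nat.RecursiveIn O f := hf
  have join : ∀ {f h : ℕ →. ℕ}, (∃ k, f ∈ S k) → (∃ k, h ∈ S k) → ∃ k, f ∈ S k ∧ h ∈ S k := by
    rintro f h ⟨k, hk⟩ ⟨l, hl⟩
    exact ⟨max k l, hmono (le_max_left _ _) hk, hmono (le_max_right _ _) hl⟩
  induction hf with
  | zero => exact ⟨0, Or.inl (Or.inl rfl)⟩
  | succ => exact ⟨0, Or.inl (Or.inr (Or.inl rfl))⟩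
  | left => exact ⟨0, Or.inl (Or.inr (Or.inr (Or.inl rfl)))⟩
  | right => exact ⟨0, Or.inl (Or.inr (Or.inr (Or.inr rfl)))⟩
  | oracle g hg => exact ⟨0, Or.inr hg⟩
  | pair _ _ ih₁ ih₂ =>
    obtain ⟨k, h₁, h₂⟩ := join ih₁ ih₂
    exact ⟨k + 1, Or.inl (Or.inl (Or.inl (Or.inr (Set.mem_image2_of_mem h₁ h₂))))⟩
  | comp _ _ ih₁ ih₂ =>
    obtain ⟨k, h₁, h₂⟩ := join ih₁ ih₂
    exact ⟨k + 1, Or.inl (Or.inl (Or.inr (Set.mem_image2_of_mem h₁ h₂)))⟩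
  | prec _ _ ih₁ ih₂ =>
    obtain ⟨k, h₁, h₂⟩ := join ih₁ ih₂
    exact ⟨k + 1, Or.inl (Or.inr (Set.mem_image2_of_mem h₁ h₂))⟩
  | rfind _ ih =>
    obtain ⟨k, h⟩ := ih
    exact ⟨k + 1, Or.inr (Set.mem_image_of_mem _ h)⟩

/-- Above every function there is a strictly more complex `0`-`1`-valued one. -/
theorem exists_strictly_above (f : ℕ → ℕ) :
    ∃ d : ℕ → Bool, Nat.RecursiveIn {((fun n => (d n).toNat : ℕ → ℕ) : ℕ →. ℕ)} (f : ℕ →. ℕ) ∧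
      ¬ Nat.RecursiveIn {(f : ℕ →. ℕ)} ((fun n => (d n).toNat : ℕ → ℕ) : ℕ →. ℕ) := by
  have hc := countable_setOf (Set.countable_singleton (f : ℕ →. ℕ))
  obtain ⟨e, he⟩ : ∃ e : ℕ → Bool,
      ¬ Nat.RecursiveIn {(f : ℕ →. ℕ)} ((fun n => (e n).toNat : ℕ → ℕ) : ℕ →. ℕ) := by
    by_contra! hall
    let F : (ℕ → Bool) → {g : ℕ →. ℕ | Nat.RecursiveIn {(f : ℕ →. ℕ)} g} := fun e => ⟨_, hall e⟩
    have hF : Function.Injective F := by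
      intro e e' h
      funext n
      have h₁ := congrFun (congrArg Subtype.val h) n
      have h₂ : (e n).toNat = (e' n).toNat := Part.some_injective h₁
      cases h₃ : e n <;> cases h₄ : e' n <;> simp [h₃, h₄] at h₂ ⊢
    have := hc.to_subtype
    have hcb : Countable (ℕ → Bool) := hF.countable
    obtain ⟨s, hs⟩ := exists_surjective_nat (ℕ → Bool)
    -- Cantor's diagonal argument.
    obtain ⟨k, hk⟩ := hs fun n => !s n n
    have := congrFun hk k
    simp at this
  -- The join of the graph of `f` (even places) with `e` (odd places); the graph replaces `f`
  -- because `d` takes only two values.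
  let d : ℕ → Bool := fun n => if n % 2 = 0 then decide (f (n / 2).unpair.1 = (n / 2).unpair.2)
    else e (n / 2)
  refine ⟨d, ?_, fun hd => he ?_⟩
  · refine of_isLeast (q := fun a t => 1 - (d (2 * Nat.pair a t)).toNat) ?_ (g := f) fun a => ?_
    · have h1 : Nat.RecursiveIn {((fun n => (d n).toNat : ℕ → ℕ) : ℕ →. ℕ)}
          ((fun n => (d n).toNat : ℕ → ℕ) : ℕ →. ℕ) := .oracle _ rfl
      have h2 := h1.comp_total (g := fun p => 2 * p)
        (of_primrec (Primrec.nat_mul.comp (_root_.Primrec.const 2) _root_.Primrec.id))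
      refine ((of_primrec (f := fun b => 1 - b)
        (Primrec.nat_sub.comp (_root_.Primrec.const 1) _root_.Primrec.id)).comp_total h2).of_eq fun n => ?_
      simp
    · have hq : {t | 1 - (d (2 * Nat.pair a t)).toNat = 0} = {f a} := by
        ext t
        by_cases h : f a = t
        · simp [d, h]
        · simp [d, h, Ne.symm h]
      rw [hq]
      exact isLeast_singleton
  · refine (hd.comp_total (g := fun n => 2 * n + 1) (of_primrec (Primrec.nat_add.comp
      (Primrec.nat_mul.comp (_root_.Primrec.const 2) _root_.Primrec.id) (_root_.Primrec.const 1)))).of_eq fun n => ?_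
    have h2 : (2 * n + 1) / 2 = n := by omega
    simp [d, h2]

/-- The initial segments of a function are recursive in it. -/
theorem encode_map_range (f : ℕ → ℕ) :
    Nat.RecursiveIn {(f : ℕ →. ℕ)}
      ((fun t => Encodable.encode ((List.range t).map f) : ℕ → ℕ) : ℕ →. ℕ) := by
  refine of_rec (h := fun k c => Encodable.encode (Denumerable.ofNat (List ℕ) c ++ [f k])) ?_
    fun k => by simp [List.range_succ]
  have h : Primrec₂ fun v c : ℕ => Encodable.encode (Denumerable.ofNat (List ℕ) c ++ [v]) :=
    Primrec.encode.comp (Primrec.list_concat.comp ((Primrec.ofNat (List ℕ)).comp Primrec.snd)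
      Primrec.fst)
  exact comp₂_total (f := fun p => f p.unpair.1) (g := fun p => p.unpair.2) h
    (comp_total (.oracle _ rfl) .left) .right

end Nat.RecursiveIn

/-! ### Addition of cells on codes -/

namespace PlaneConfig

/-- The number of the sum of two cells given by their numbers. -/
def cellAdd (i z : ℕ) : ℕ :=
  Encodable.encode (Denumerable.ofNat (ℤ × ℤ) i + Denumerable.ofNat (ℤ × ℤ) z)

theorem ofNat_int_even (k : ℕ) : Denumerable.ofNat ℤ (2 * k) = k := by
  rw [← Denumerable.ofNat_encode (k : ℤ)]
  rfl

theorem ofNat_int_odd (k : ℕ) : Denumerable.ofNat ℤ (2 * k + 1) = -(k + 1 : ℤ) := by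
  rw [← Int.negSucc_eq, ← Denumerable.ofNat_encode (Int.negSucc k)]
  rfl

/-- The code of ℤ is the zigzag one: `2 * k` stands for `k` and `2 * k + 1` for `-(k + 1)`. Mixed
parities give a difference, whose sign decides the parity of the result. -/
theorem encode_int_add_eq (a b : ℕ) :
    Encodable.encode (Denumerable.ofNat ℤ a + Denumerable.ofNat ℤ b) =
      if a % 2 = 0 then
        if b % 2 = 0 then a + b else if b < a then a - b - 1 else b - a
      else
        if b % 2 = 0 then (if a < b then b - a - 1 else a - b) else a + b + 1 := by
  have key : ∀ n : ℕ, ∀ u : ℤ, Denumerable.ofNat ℤ n = u → Encodable.encode u = n := by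
    rintro n u rfl
    exact Denumerable.encode_ofNat n
  apply key
  obtain ⟨p, hp⟩ := Nat.even_or_odd' a
  obtain ⟨q, hq⟩ := Nat.even_or_odd' b
  rcases hp with rfl | rfl <;> rcases hq with rfl | rfl
  · rw [if_pos (by omega), if_pos (by omega), ← mul_add]
    simp only [ofNat_int_even]
    push_cast; ring
  · rw [if_pos (by omega), if_neg (by omega), ofNat_int_even, ofNat_int_odd]
    split_ifs with h
    · rw [show 2 * p - (2 * q + 1) - 1 = 2 * (p - q - 1) by omega, ofNat_int_even]; omega
    · rw [show 2 * q + 1 - 2 * p = 2 * (q - p) + 1 by omega, ofNat_int_odd]; omega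
  · rw [if_neg (by omega), if_pos (by omega), ofNat_int_even, ofNat_int_odd]
    split_ifs with h
    · rw [show 2 * q - (2 * p + 1) - 1 = 2 * (q - p - 1) by omega, ofNat_int_even]; omega
    · rw [show 2 * p + 1 - 2 * q = 2 * (p - q) + 1 by omega, ofNat_int_odd]; omega
  · rw [if_neg (by omega), if_neg (by omega), ofNat_int_odd, ofNat_int_odd,
      show 2 * p + 1 + (2 * q + 1) + 1 = 2 * (p + q + 1) + 1 by omega, ofNat_int_odd]
    push_cast; ring

theorem primrec_encode_int_add :
    Primrec₂ fun a b : ℕ => Encodable.encode (Denumerable.ofNat ℤ a + Denumerable.ofNat ℤ b) := by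
  have even : ∀ {g : ℕ × ℕ → ℕ}, Primrec g → PrimrecPred fun p => g p % 2 = 0 := fun hg =>
    Primrec.eq.comp (Primrec.nat_mod.comp hg (Primrec.const 2)) (Primrec.const 0)
  have diff : ∀ {g h : ℕ × ℕ → ℕ}, Primrec g → Primrec h →
      Primrec fun p => if h p < g p then g p - h p - 1 else h p - g p := fun hg hh =>
    Primrec.ite (Primrec.nat_lt.comp hh hg)
      (Primrec.nat_sub.comp (Primrec.nat_sub.comp hg hh) (Primrec.const 1))
      (Primrec.nat_sub.comp hh hg)
  have add : Primrec fun p : ℕ × ℕ => p.1 + p.2 := Primrec.nat_add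
  have H : Primrec fun p : ℕ × ℕ => if p.1 % 2 = 0 then
        if p.2 % 2 = 0 then p.1 + p.2 else if p.2 < p.1 then p.1 - p.2 - 1 else p.2 - p.1
      else
        if p.2 % 2 = 0 then (if p.1 < p.2 then p.2 - p.1 - 1 else p.1 - p.2)
        else p.1 + p.2 + 1 :=
    Primrec.ite (even Primrec.fst)
      (Primrec.ite (even Primrec.snd) add (diff Primrec.fst Primrec.snd))
      (Primrec.ite (even Primrec.snd) (diff Primrec.snd Primrec.fst) (Primrec.succ.comp add))
  exact H.of_eq fun p => (encode_int_add_eq p.1 p.2).symm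

theorem primrec_cellAdd : Primrec₂ cellAdd := by
  have h1 : Primrec fun n : ℕ => n.unpair.1 := Primrec.fst.comp Primrec.unpair
  have h2 : Primrec fun n : ℕ => n.unpair.2 := Primrec.snd.comp Primrec.unpair
  refine (Primrec₂.natPair.comp
    (primrec_encode_int_add.comp (h1.comp Primrec.fst) (h1.comp Primrec.snd))
    (primrec_encode_int_add.comp (h2.comp Primrec.fst) (h2.comp Primrec.snd))).of_eq fun p => ?_
  simp [cellAdd, Encodable.encode_prod_val]

/-! ### Returns of initial segments -/

theorem code_shift {A : Type*} [Encodable A] (v : ℤ × ℤ) (x : ℤ × ℤ → A) (i : ℕ) :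
    code (SymbolicDynamics.FullShift.shift v x) i = code x (cellAdd i (Encodable.encode v)) := by
  simp only [code, cellAdd, Denumerable.ofNat_encode, SymbolicDynamics.FullShift.shift_apply,
    add_comm]

/-- Inside the initial segment of length `t`, the sequence `f` shows a translate that agrees with
`f` on the cells before some cell `c ≥ n`, and at `c` the two letters are in relation `R`. -/
def Returns (R : ℕ → ℕ → Prop) (f : ℕ → ℕ) (n t : ℕ) : Prop :=
  ∃ z < t, ∃ c < t, n ≤ c ∧ (∀ i < c + 1, cellAdd i z < t) ∧ (∀ i < c, f i = f (cellAdd i z)) ∧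
    R (f c) (f (cellAdd c z))

theorem Returns.lt {R : ℕ → ℕ → Prop} {f : ℕ → ℕ} {n t : ℕ} (h : Returns R f n t) : n < t := by
  obtain ⟨z, -, c, hc, hn, -⟩ := h
  omega

theorem Returns.congr {R : ℕ → ℕ → Prop} {f g : ℕ → ℕ} {n t : ℕ} (hfg : ∀ i < t, f i = g i)
    (h : Returns R f n t) : Returns R g n t := by
  obtain ⟨z, hz, c, hc, hn, ht, he, hR⟩ := h
  refine ⟨z, hz, c, hc, hn, ht, fun i hi => ?_, ?_⟩
  · rw [← hfg i (by omega), ← hfg _ (ht i (by omega))]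
    exact he i hi
  · rwa [← hfg c hc, ← hfg _ (ht c (by omega))]

theorem returns_congr {R : ℕ → ℕ → Prop} {f g : ℕ → ℕ} {n t : ℕ} (hfg : ∀ i < t, f i = g i) :
    Returns R f n t ↔ Returns R g n t :=
  ⟨.congr hfg, .congr fun i hi => (hfg i hi).symm⟩

theorem primrecRel_forall_lt {β : Type*} [Primcodable β] {R : ℕ → β → Prop} (hR : PrimrecRel R) :
    PrimrecRel fun n b => ∀ i < n, R i b :=
  (hR.forall_mem_list.comp (Primrec.list_range.comp Primrec.fst) Primrec.snd).of_eq (by simp)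

theorem primrecRel_exists_lt {β : Type*} [Primcodable β] {R : ℕ → β → Prop} (hR : PrimrecRel R) :
    PrimrecRel fun n b => ∃ i < n, R i b :=
  (hR.exists_mem_list.comp (Primrec.list_range.comp Primrec.fst) Primrec.snd).of_eq (by simp)

/-- All quantifiers are bounded by the length of the list. The bounds in `Returns` keep every index
inside the list, so the default value `0` never affects the truth value. -/
theorem primrecRel_returns {R : ℕ → ℕ → Prop} (hR : PrimrecRel R) :
    PrimrecRel fun (L : List ℕ) (n : ℕ) => Returns R (fun i => L.getD i 0) n L.length := by
  have hget : ∀ {α : Type} [Primcodable α] {l : α → List ℕ} {g : α → ℕ}, Primrec l → Primrec g →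
      Primrec fun a => (l a).getD (g a) 0 := fun hl hg => (Primrec.list_getD 0).comp hl hg
  have hc : Primrec fun p : ℕ × (ℕ × (List ℕ × ℕ)) => p.1 := Primrec.fst
  have hz : Primrec fun p : ℕ × (ℕ × (List ℕ × ℕ)) => p.2.1 := Primrec.fst.comp Primrec.snd
  have hL : Primrec fun p : ℕ × (ℕ × (List ℕ × ℕ)) => p.2.2.1 :=
    Primrec.fst.comp (Primrec.snd.comp Primrec.snd)
  have hn : Primrec fun p : ℕ × (ℕ × (List ℕ × ℕ)) => p.2.2.2 :=
    Primrec.snd.comp (Primrec.snd.comp Primrec.snd)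
  have h1 : PrimrecRel fun (i : ℕ) (q : ℕ × List ℕ) => cellAdd i q.1 < q.2.length :=
    Primrec.nat_lt.comp (primrec_cellAdd.comp Primrec.fst (Primrec.fst.comp Primrec.snd))
      (Primrec.list_length.comp (Primrec.snd.comp Primrec.snd))
  have h2 : PrimrecRel fun (i : ℕ) (q : ℕ × List ℕ) =>
      q.2.getD i 0 = q.2.getD (cellAdd i q.1) 0 :=
    Primrec.eq.comp (hget (Primrec.snd.comp Primrec.snd) Primrec.fst)
      (hget (Primrec.snd.comp Primrec.snd)
        (primrec_cellAdd.comp Primrec.fst (Primrec.fst.comp Primrec.snd)))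
  have h3a : PrimrecPred fun p : ℕ × (ℕ × (List ℕ × ℕ)) => p.2.2.2 ≤ p.1 :=
    Primrec.nat_le.comp hn hc
  have h3b : PrimrecPred fun p : ℕ × (ℕ × (List ℕ × ℕ)) =>
      ∀ i < p.1 + 1, cellAdd i p.2.1 < p.2.2.1.length :=
    (primrecRel_forall_lt h1).comp (f := fun p : ℕ × (ℕ × (List ℕ × ℕ)) => p.1 + 1)
      (g := fun p => (p.2.1, p.2.2.1)) (Primrec.succ.comp hc) (hz.pair hL)
  have h3c : PrimrecPred fun p : ℕ × (ℕ × (List ℕ × ℕ)) =>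
      ∀ i < p.1, p.2.2.1.getD i 0 = p.2.2.1.getD (cellAdd i p.2.1) 0 :=
    (primrecRel_forall_lt h2).comp (f := fun p : ℕ × (ℕ × (List ℕ × ℕ)) => p.1)
      (g := fun p => (p.2.1, p.2.2.1)) hc (hz.pair hL)
  have h3d : PrimrecPred fun p : ℕ × (ℕ × (List ℕ × ℕ)) =>
      R (p.2.2.1.getD p.1 0) (p.2.2.1.getD (cellAdd p.1 p.2.1) 0) :=
    hR.comp (f := fun p : ℕ × (ℕ × (List ℕ × ℕ)) => p.2.2.1.getD p.1 0)
      (g := fun p => p.2.2.1.getD (cellAdd p.1 p.2.1) 0) (hget hL hc)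
      (hget hL (primrec_cellAdd.comp hc hz))
  have h3 : PrimrecRel fun (c : ℕ) (q : ℕ × (List ℕ × ℕ)) => q.2.2 ≤ c ∧
      (∀ i < c + 1, cellAdd i q.1 < q.2.1.length) ∧
      (∀ i < c, q.2.1.getD i 0 = q.2.1.getD (cellAdd i q.1) 0) ∧
      R (q.2.1.getD c 0) (q.2.1.getD (cellAdd c q.1) 0) :=
    h3a.and (h3b.and (h3c.and h3d))
  have h4 : PrimrecRel fun (z : ℕ) (q : List ℕ × ℕ) => ∃ c < q.1.length, q.2 ≤ c ∧
      (∀ i < c + 1, cellAdd i z < q.1.length) ∧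
      (∀ i < c, q.1.getD i 0 = q.1.getD (cellAdd i z) 0) ∧
      R (q.1.getD c 0) (q.1.getD (cellAdd c z) 0) :=
    (primrecRel_exists_lt h3).comp (f := fun p : ℕ × (List ℕ × ℕ) => p.2.1.length) (g := fun p => p)
      (Primrec.list_length.comp (Primrec.fst.comp Primrec.snd)) Primrec.id
  exact (primrecRel_exists_lt h4).comp (f := fun p : List ℕ × ℕ => p.1.length) (g := fun p => p)
    (Primrec.list_length.comp Primrec.fst) Primrec.id

open Nat.RecursiveIn in
/-- The test for returns in initial segments of a sequence is recursive in the sequence. -/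
theorem recursiveIn_returns {R : ℕ → ℕ → Prop} (hR : PrimrecRel R) (f : ℕ → ℕ) :
    ∃ q : ℕ → ℕ → ℕ,
      Nat.RecursiveIn {(f : ℕ →. ℕ)} ((fun p => q p.unpair.1 p.unpair.2 : ℕ → ℕ) : ℕ →. ℕ) ∧
        ∀ n t, (Returns R f n t → q n t = 0) ∧ (¬ Returns R f n t → q n t = 1) := by
  classical
  let P : ℕ → ℕ → Prop := fun n c => Returns R (fun i => (Denumerable.ofNat (List ℕ) c).getD i 0) n
    (Denumerable.ofNat (List ℕ) c).length
  have hP : PrimrecRel P :=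
    (primrecRel_returns hR).comp ((Primrec.ofNat (List ℕ)).comp Primrec.snd) Primrec.fst
  have hQ : Primrec₂ fun n c => if P n c then 0 else 1 :=
    Primrec.ite hP (Primrec.const 0) (Primrec.const 1)
  refine ⟨fun n t => if P n (Encodable.encode ((List.range t).map f)) then 0 else 1,
    comp₂_total (f := fun p => p.unpair.1) hQ .left
      (comp_total (encode_map_range f) (g := fun p => p.unpair.2) .right), fun n t => ?_⟩
  have hiff : P n (Encodable.encode ((List.range t).map f)) ↔ Returns R f n t := by
    simp only [P, Denumerable.ofNat_encode, List.length_map, List.length_range]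
    refine returns_congr fun i hi => ?_
    simp [hi]
  exact ⟨fun h => if_pos (hiff.2 h), fun h => if_neg (mt hiff.1 h)⟩

open Nat.RecursiveIn in
/-- The bits read off the successive first returns of a sequence are recursive in it. -/
theorem recursiveIn_of_returns {f N : ℕ → ℕ} {d : ℕ → Bool}
    (hex : ∀ n, ∃ t, Returns (· ≠ ·) f n t)
    (hN : ∀ i, IsLeast {t | Returns (· ≠ ·) f (N i) t} (N (i + 1)))
    (hd : ∀ i, d i = true ↔ Returns (· > ·) f (N i) (N (i + 1))) :
    Nat.RecursiveIn {(f : ℕ →. ℕ)} ((fun i => (d i).toNat : ℕ → ℕ) : ℕ →. ℕ) := by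
  classical
  have hne : PrimrecRel fun a b : ℕ => a ≠ b := Primrec.eq.not
  have hgt : PrimrecRel fun a b : ℕ => a > b := Primrec.nat_lt.comp Primrec.snd Primrec.fst
  obtain ⟨q, hq, hq'⟩ := recursiveIn_returns hne f
  obtain ⟨b, hb, hb'⟩ := recursiveIn_returns hgt f
  have hset : ∀ n, {t | q n t = 0} = {t | Returns (· ≠ ·) f n t} := by
    intro n
    ext t
    by_cases h : Returns (· ≠ ·) f n t
    · simp [h, (hq' n t).1 h]
    · simp [h, (hq' n t).2 h]
  have hnext : Nat.RecursiveIn {(f : ℕ →. ℕ)} ((fun n => Nat.find (hex n) : ℕ → ℕ) : ℕ →. ℕ) := by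
    refine of_isLeast hq fun n => ?_
    rw [hset]
    exact ⟨Nat.find_spec (hex n), fun t ht => Nat.find_min' _ ht⟩
  have hNrec : Nat.RecursiveIn {(f : ℕ →. ℕ)} (N : ℕ →. ℕ) := by
    refine of_rec (h := fun _ n => Nat.find (hex n))
      (comp_total hnext (g := fun p => p.unpair.2) .right) fun k => ?_
    exact (hN k).unique ⟨Nat.find_spec (hex _), fun t ht => Nat.find_min' _ ht⟩
  have hpair := pair_total hNrec (comp_total hNrec (of_primrec Primrec.succ))
  -- The test `b` answers `0` for yes, so `1 - v` turns it into the bit.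
  refine (comp_total (of_primrec (f := fun v => 1 - v)
    (Primrec.nat_sub.comp (Primrec.const 1) Primrec.id)) (comp_total hb hpair)).of_eq fun i => ?_
  by_cases h : Returns (· > ·) f (N i) (N (i + 1))
  · simp [(hd i).2 h, (hb' _ _).1 h]
  · have hdi : d i = false := by simpa using mt (hd i).1 h
    simp [hdi, (hb' _ _).2 h]

/-! ### Periodic configurations -/

/-- A configuration with two independent periods, horizontal and vertical, is computable. -/
theorem isComputable_of_periodic {A : Type*} [Encodable A] (x : ℤ × ℤ → A) {a : ℕ} (ha : 0 < a)
    (h₁ : ∀ u v, x (u + a, v) = x (u, v)) (h₂ : ∀ u v, x (u, v + a) = x (u, v)) :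
    IsComputable x := by
  let F : ℕ → ℕ → ℕ := fun u v =>
    Encodable.encode (x (Denumerable.ofNat ℤ u, Denumerable.ofNat ℤ v))
  -- In the zigzag code, adding `2 * a` moves the integer by `a` away from zero, on whichever side
  -- it lies. Periods of `x` thus become periods `2 * a` on codes, and a finite table determines
  -- `x`.
  have hstep : ∀ u : ℕ, Denumerable.ofNat ℤ (u + 2 * a) = Denumerable.ofNat ℤ u + a ∨
      Denumerable.ofNat ℤ (u + 2 * a) + a = Denumerable.ofNat ℤ u := by
    intro u
    obtain ⟨p, rfl | rfl⟩ := Nat.even_or_odd' u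
    · left
      rw [← mul_add, ofNat_int_even, ofNat_int_even]; push_cast; ring
    · right
      rw [show 2 * p + 1 + 2 * a = 2 * (p + a) + 1 by ring, ofNat_int_odd, ofNat_int_odd]
      push_cast; ring
  have hF₁ : ∀ v, Function.Periodic (fun u => F u v) (2 * a) := by
    intro v u
    rcases hstep u with h | h
    · simp only [F]; rw [h, h₁]
    · simp only [F]; rw [← h, h₁]
  have hF₂ : ∀ u, Function.Periodic (fun v => F u v) (2 * a) := by
    intro u v
    rcases hstep v with h | h
    · simp only [F]; rw [h, h₂]
    · simp only [F]; rw [← h, h₂]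
  have hpos : 0 < 2 * a := by omega
  have hfin : Primrec fun p : Fin (2 * a) × Fin (2 * a) => F p.1 p.2 := Primrec.dom_finite _
  have : NeZero (2 * a) := ⟨hpos.ne'⟩
  have hres : Primrec fun n : ℕ => (⟨n % (2 * a), Nat.mod_lt _ hpos⟩ : Fin (2 * a)) :=
    Primrec.fin_val_iff.1 (Primrec.nat_mod.comp Primrec.id (Primrec.const _))
  refine Primrec.to_comp ((hfin.comp
    ((hres.comp (Primrec.fst.comp Primrec.unpair)).pair
      (hres.comp (Primrec.snd.comp Primrec.unpair)))).of_eq fun n => ?_)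
  have e₁ := (hF₁ (n.unpair.2 % (2 * a))).map_mod_nat n.unpair.1
  have e₂ := (hF₂ n.unpair.1).map_mod_nat n.unpair.2
  simp only [code, Denumerable.prod_ofNat_val]
  exact e₁.trans e₂

end PlaneConfig

open SymbolicDynamics.FullShift (shift)

/-! ### Minimal subshifts and finite orbits -/

namespace PlaneConfig

section

variable {A : Type*} [TopologicalSpace A]

/-- Non-empty closed shift-invariant sets of configurations. -/
def IsInvariantClosed (Y : Set (ℤ × ℤ → A)) : Prop :=
  Y.Nonempty ∧ IsClosed Y ∧ ∀ v, Set.MapsTo (shift v) Y Y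

theorem IsInvariantClosed.exists_minimal [CompactSpace A] {X : Set (ℤ × ℤ → A)}
    (hX : IsInvariantClosed X) : ∃ M ⊆ X, Minimal IsInvariantClosed M := by
  refine zorn_superset_nonempty {Y | IsInvariantClosed Y} (fun c hc hchain hne => ?_) X hX
  refine ⟨⋂₀ c, ⟨?_, isClosed_sInter fun s hs => (hc hs).2.1, fun v x hx s hs =>
    (hc hs).2.2 v (hx s hs)⟩, fun s hs => Set.sInter_subset_of_mem hs⟩
  have := hne.to_subtype
  exact IsCompact.nonempty_sInter_of_directed_nonempty_isCompact_isClosed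
    (fun s hs t ht => (hchain.total hs ht).elim (fun h => ⟨s, hs, subset_rfl, h⟩)
      fun h => ⟨t, ht, h, subset_rfl⟩) (fun s hs => (hc hs).1)
    (fun s hs => (hc hs).2.1.isCompact) fun s hs => (hc hs).2.1

/-- Otherwise the points of `M` whose orbits avoid `U` would form a smaller closed invariant set,
still non-empty because of `y`. -/
theorem exists_shift_mem {M U : Set (ℤ × ℤ → A)} (hM : Minimal IsInvariantClosed M)
    (hU : IsOpen U) (hMU : (M ∩ U).Nonempty) {y : ℤ × ℤ → A} (hy : y ∈ M) :
    ∃ v, shift v y ∈ U := by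
  by_contra! hno
  have hY : IsInvariantClosed {x ∈ M | ∀ v, shift v x ∉ U} := by
    refine ⟨⟨y, hy, hno⟩, hM.prop.2.1.inter ?_, fun v x hx => ⟨hM.prop.2.2 v hx.1, fun w => ?_⟩⟩
    · have : {x : ℤ × ℤ → A | ∀ v, shift v x ∉ U} = ⋂ v, shift v ⁻¹' Uᶜ := by ext; simp
      change IsClosed {x : ℤ × ℤ → A | ∀ v, shift v x ∉ U}
      rw [this]
      exact isClosed_iInter fun v => hU.isClosed_compl.preimage
        (SymbolicDynamics.FullShift.continuous_shift v)
    · rw [← SymbolicDynamics.FullShift.shift_add]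
      exact hx.2 _
  obtain ⟨x, hxM, hxU⟩ := hMU
  have := (hM.le_of_le hY (Set.sep_subset _ _) hxM).2 0
  rw [SymbolicDynamics.FullShift.shift_zero] at this
  exact this hxU

/-- By compactness finitely many shifts `v` suffice to bring every point of `M` into `U`. An orbit
point brought into `U` by `v` lands on `m`, so it is the shift of `m` by `-v`. -/
theorem finite_orbit {M U : Set (ℤ × ℤ → A)} [CompactSpace A]
    (hM : Minimal IsInvariantClosed M) (hU : IsOpen U) {m : ℤ × ℤ → A} (hm : m ∈ M) (hmU : m ∈ U)
    (hper : ∀ v, shift v m ∈ U → shift v m = m) : (Set.range fun v => shift v m).Finite := by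
  obtain ⟨F, hF⟩ := hM.prop.2.1.isCompact.elim_finite_subcover (fun v => shift v ⁻¹' U)
    (fun v => hU.preimage (SymbolicDynamics.FullShift.continuous_shift v)) fun y hy =>
      Set.mem_iUnion.2 (exists_shift_mem hM hU ⟨m, hm, hmU⟩ hy)
  refine (F.finite_toSet.image fun v => shift (-v) m).subset ?_
  rintro _ ⟨c, rfl⟩
  obtain ⟨v, hv, hvU⟩ := Set.mem_iUnion₂.1 (hF (hM.prop.2.2 c hm))
  refine ⟨v, hv, ?_⟩
  have hvU' : shift v (shift c m) ∈ U := hvU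
  rw [← SymbolicDynamics.FullShift.shift_add] at hvU'
  have h := hper _ hvU'
  have h2 : shift (-v) (shift (c + v) m) = shift (-v) m := by rw [h]
  rw [← SymbolicDynamics.FullShift.shift_add, add_neg_cancel_right] at h2
  exact h2.symm

end

section

variable {A : Type*}

theorem exists_period_of_finite_orbit {m : ℤ × ℤ → A} (h : (Set.range fun v => shift v m).Finite)
    (e : ℤ × ℤ) : ∃ a : ℕ, 0 < a ∧ shift (a • e) m = m := by
  have := h.to_subtype
  obtain ⟨k, l, hkl, heq⟩ := Finite.exists_ne_map_eq_of_infinite fun k : ℕ =>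
    (⟨shift (k • e) m, Set.mem_range_self _⟩ : Set.range fun v => shift v m)
  have key : ∀ k l : ℕ, k < l → shift (k • e) m = shift (l • e) m →
      ∃ a : ℕ, 0 < a ∧ shift (a • e) m = m := by
    intro k l hlt h
    refine ⟨l - k, by omega, ?_⟩
    have h2 : shift (-(k • e)) (shift (k • e) m) = shift (-(k • e)) (shift (l • e) m) := by rw [h]
    rw [← SymbolicDynamics.FullShift.shift_add, ← SymbolicDynamics.FullShift.shift_add,
      add_neg_cancel, SymbolicDynamics.FullShift.shift_zero] at h2
    rw [sub_nsmul _ hlt.le]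
    exact h2.symm
  have heq' : shift (k • e) m = shift (l • e) m := congrArg Subtype.val heq
  rcases lt_or_gt_of_ne hkl with hlt | hlt
  · exact key k l hlt heq'
  · exact key l k hlt heq'.symm

theorem shift_nsmul_eq {m : ℤ × ℤ → A} {e : ℤ × ℤ} (h : shift e m = m) (k : ℕ) :
    shift (k • e) m = m := by
  induction k with
  | zero => simp
  | succ k ih => rw [succ_nsmul, SymbolicDynamics.FullShift.shift_add, ih, h]

theorem isComputable_of_finite_orbit [Encodable A] {m : ℤ × ℤ → A}
    (h : (Set.range fun v => shift v m).Finite) : IsComputable m := by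
  obtain ⟨a, ha, ham⟩ := exists_period_of_finite_orbit h (1, 0)
  obtain ⟨b, hb, hbm⟩ := exists_period_of_finite_orbit h (0, 1)
  -- The product `a * b` serves as a common period in both directions.
  have h₁ := shift_nsmul_eq ham b
  have h₂ := shift_nsmul_eq hbm a
  refine isComputable_of_periodic m (Nat.mul_pos ha hb) (fun u v => ?_) fun u v => ?_
  · have := congrFun h₁ (u, v)
    rw [SymbolicDynamics.FullShift.shift_apply] at this
    rw [← this]
    congr 1
    ext <;> simp
    ring
  · have := congrFun h₂ (u, v)
    rw [SymbolicDynamics.FullShift.shift_apply] at this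
    rw [← this]
    congr 1
    ext <;> simp
    ring

theorem code_injective [Encodable A] : Function.Injective (code (A := A)) := by
  intro x y h
  funext v
  have := congrFun h (Encodable.encode v)
  simpa only [code, Denumerable.ofNat_encode, Encodable.encode_inj] using this

end

/-! ### Coding bits into a point of a minimal set -/

variable {A : Type*} [Encodable A] [TopologicalSpace A] [DiscreteTopology A]

theorem continuous_code_apply (i : ℕ) : Continuous fun x : ℤ × ℤ → A => code x i :=
  (continuous_of_discreteTopology (f := fun a : A => Encodable.encode a)).comp (continuous_apply _)

theorem isClosed_agree (f : ℕ → ℕ) (n : ℕ) :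
    IsClosed {x : ℤ × ℤ → A | ∀ i < n, code x i = f i} := by
  simp only [Set.ofPred_forall]
  exact isClosed_iInter fun i => isClosed_iInter fun _ =>
    isClosed_eq (continuous_code_apply i) continuous_const

theorem isOpen_agree (f : ℕ → ℕ) (n : ℕ) :
    IsOpen {x : ℤ × ℤ → A | ∀ i < n, code x i = f i} := by
  have : {x : ℤ × ℤ → A | ∀ i < n, code x i = f i} =
      ⋂ i ∈ Finset.range n, (fun x => code x i) ⁻¹' {f i} := by ext; simp
  rw [this]
  exact isOpen_biInter_finset fun i _ => (isOpen_discrete _).preimage (continuous_code_apply i)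

/-- In a minimal set without computable points, all initial segments of a point return in it at a
translate different from the point. -/
theorem exists_returns [CompactSpace A] {M : Set (ℤ × ℤ → A)} (hM : Minimal IsInvariantClosed M)
    {m : ℤ × ℤ → A} (hm : m ∈ M) (hc : ¬ IsComputable m) (n : ℕ) :
    ∃ t, Returns (· ≠ ·) (code m) n t := by
  classical
  obtain ⟨v, hv, hne⟩ : ∃ v, (∀ i < n, code (shift v m) i = code m i) ∧ shift v m ≠ m := by
    by_contra! hall
    exact hc (isComputable_of_finite_orbit
      (finite_orbit hM (isOpen_agree (code m) n) hm (fun _ _ => rfl) hall))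
  have hex : ∃ c, code (shift v m) c ≠ code m c := by
    by_contra! hall
    exact hne (code_injective (funext hall))
  set c := Nat.find hex
  have hcne : code (shift v m) c ≠ code m c := Nat.find_spec hex
  have hceq : ∀ i < c, code (shift v m) i = code m i := fun i hi => not_not.1 (Nat.find_min hex hi)
  set z := Encodable.encode v
  -- The sum exceeds `z`, `c` and every cell number that the return inspects.
  refine ⟨z + c + 1 + ∑ i ∈ Finset.range (c + 1), cellAdd i z, z, by omega, c, by omega,
    not_lt.1 fun h => hcne (hv c h), fun i hi => ?_, fun i hi => ?_, ?_⟩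
  · have := Finset.single_le_sum (f := fun i => cellAdd i z) (fun _ _ => Nat.zero_le _)
      (Finset.mem_range.2 hi)
    omega
  · rw [← code_shift, hceq i hi]
  · rw [← code_shift]
    exact hcne.symm

/-- A non-empty compact set of configurations has a lexicographically largest element, for
letters compared through `φ`. -/
theorem exists_lex_max (φ : ℕ → ℤ) {C : Set (ℤ × ℤ → A)} (hC : IsCompact C) (hne : C.Nonempty) :
    ∃ m ∈ C, ∀ x ∈ C, ∀ c, (∀ i < c, code x i = code m i) →
      φ (code x c) ≤ φ (code m c) := by
  have hcont : ∀ k, Continuous fun x : ℤ × ℤ → A => φ (code x k) := fun k =>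
    continuous_of_discreteTopology.comp (continuous_code_apply k)
  -- `D (k + 1)` keeps the points of `D k` whose letter at cell `k` is largest; a point of the
  -- intersection is the maximum.
  let D : ℕ → Set (ℤ × ℤ → A) := fun k =>
    Nat.rec C (fun k E => {x ∈ E | ∀ y ∈ E, φ (code y k) ≤ φ (code x k)}) k
  have hD : ∀ k, D (k + 1) = {x ∈ D k | ∀ y ∈ D k, φ (code y k) ≤ φ (code x k)} := fun _ => rfl
  have hsub : ∀ k, D (k + 1) ⊆ D k := fun k => hD k ▸ Set.sep_subset _ _
  have hcl : ∀ k, IsClosed (D k) := by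
    intro k
    induction k with
    | zero => exact hC.isClosed
    | succ k ih =>
      refine IsClosed.inter ih ?_
      change IsClosed {x : ℤ × ℤ → A | ∀ y ∈ D k, φ (code y k) ≤ φ (code x k)}
      simp only [Set.ofPred_forall]
      exact isClosed_iInter fun y => isClosed_iInter fun _ => isClosed_le continuous_const (hcont k)
  have hsubC : ∀ k, D k ⊆ C := by
    intro k
    induction k with
    | zero => exact subset_rfl
    | succ k ih => exact (hsub k).trans ih
  have hnon : ∀ k, (D k).Nonempty := by
    intro k
    induction k with
    | zero => exact hne
    | succ k ih =>
      obtain ⟨x, hx, hmax⟩ := (hC.of_isClosed_subset (hcl k) (hsubC k)).exists_isMaxOn ih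
        (hcont k).continuousOn
      exact ⟨x, hx, fun y hy => hmax hy⟩
  obtain ⟨m, hm⟩ := IsCompact.nonempty_iInter_of_sequence_nonempty_isCompact_isClosed D hsub hnon
    hC hcl
  rw [Set.mem_iInter] at hm
  refine ⟨m, hm 0, fun x hx c hxm => ?_⟩
  have : ∀ k ≤ c, x ∈ D k := by
    intro k
    induction k with
    | zero => exact fun _ => hx
    | succ k ih =>
      intro hk
      refine ⟨ih (by omega), fun y hy => ?_⟩
      rw [hxm k (by omega)]
      exact (hm (k + 1)).2 y hy
  exact (hm (c + 1)).2 x (this c le_rfl)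

/-- Every initial segment of a point of `M` extends to a point of `M` whose first return carries a
prescribed bit. -/
theorem exists_extension [CompactSpace A] {M : Set (ℤ × ℤ → A)}
    (hM : Minimal IsInvariantClosed M) (hc : ∀ m ∈ M, ¬ IsComputable m) (b : Bool)
    (m : M) (n : ℕ) : ∃ (m' : M) (n' : ℕ), (∀ i < n, code m'.1 i = code m.1 i) ∧
      IsLeast {t | Returns (· ≠ ·) (code m'.1) n t} n' ∧
        (b = true ↔ Returns (· > ·) (code m'.1) n n') := by
  classical
  have hcpt : IsCompact (M ∩ {x | ∀ i < n, code x i = code m.1 i}) :=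
    (hM.prop.2.1.inter (isClosed_agree (code m.1) n)).isCompact
  have hne : (M ∩ {x | ∀ i < n, code x i = code m.1 i}).Nonempty := ⟨m, m.2, fun _ _ => rfl⟩
  -- Negating the letter numbers for `b = false` turns the maximum into a minimum.
  obtain ⟨x, ⟨hxM, hxm⟩, hmax⟩ := exists_lex_max (fun k => if b then (k : ℤ) else -k) hcpt hne
  -- A translate that agrees with `x` before some `c ≥ n` has the prescribed prefix, so it competes
  -- with `x`. This holds for every return, so it does not matter which one realizes the least `t`.
  have hle : ∀ z c, n ≤ c → (∀ i < c, code x i = code x (cellAdd i z)) →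
      (if b then (code x (cellAdd c z) : ℤ) else -code x (cellAdd c z)) ≤
        if b then (code x c : ℤ) else -code x c := by
    intro z c hnc heq
    have hsh : ∀ i, code (shift (Denumerable.ofNat (ℤ × ℤ) z) x) i = code x (cellAdd i z) := by
      intro i
      rw [code_shift, Denumerable.encode_ofNat]
    have := hmax (shift (Denumerable.ofNat (ℤ × ℤ) z) x) ⟨hM.prop.2.2 _ hxM, fun i hi => by
      rw [hsh, ← heq i (by omega), hxm i hi]⟩ c fun i hi => by rw [hsh, heq i hi]
    rwa [hsh] at this
  have hex := exists_returns hM hxM (hc x hxM) n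
  refine ⟨⟨x, hxM⟩, Nat.find hex, hxm, ⟨Nat.find_spec hex, fun t ht => Nat.find_min' hex ht⟩, ?_⟩
  constructor
  · rintro rfl
    obtain ⟨z, hz, c, hc, hnc, ht, heq, hR⟩ := Nat.find_spec hex
    refine ⟨z, hz, c, hc, hnc, ht, heq, ?_⟩
    have := hle z c hnc heq
    simp only [if_true, Nat.cast_le] at this
    exact lt_of_le_of_ne this hR.symm
  · rintro ⟨z, hz, c, hc, hnc, ht, heq, hR⟩
    by_contra hb
    have := hle z c hnc heq
    simp only [if_neg hb] at this
    have hR' : code x (cellAdd c z) < code x c := hR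
    omega

/-- Every sequence of bits is recursive in some point of a minimal set without computable
points. -/
theorem exists_mem_recursiveIn [CompactSpace A] {M : Set (ℤ × ℤ → A)}
    (hM : Minimal IsInvariantClosed M) (hc : ∀ m ∈ M, ¬ IsComputable m) (d : ℕ → Bool) :
    ∃ y ∈ M, Nat.RecursiveIn {(code y : ℕ →. ℕ)} ((fun i => (d i).toNat : ℕ → ℕ) : ℕ →. ℕ) := by
  choose ext len hagree hleast hbit using exists_extension hM hc
  obtain ⟨x, hx⟩ := hM.prop.1
  let s : ℕ → M × ℕ := fun i =>
    Nat.rec (⟨x, hx⟩, 0) (fun i p => (ext (d i) p.1 p.2, len (d i) p.1 p.2)) i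
  let m : ℕ → ℤ × ℤ → A := fun i => (s i).1.1
  let N : ℕ → ℕ := fun i => (s i).2
  have hstep : ∀ i, ∀ j < N i, code (m (i + 1)) j = code (m i) j := fun i =>
    hagree (d i) (s i).1 (s i).2
  have hN : ∀ i, IsLeast {t | Returns (· ≠ ·) (code (m (i + 1))) (N i) t} (N (i + 1)) := fun i =>
    hleast (d i) (s i).1 (s i).2
  have hd : ∀ i, d i = true ↔ Returns (· > ·) (code (m (i + 1))) (N i) (N (i + 1)) := fun i =>
    hbit (d i) (s i).1 (s i).2
  have hlt : StrictMono N := strictMono_nat_of_lt_succ fun i => (hN i).1.lt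
  have hmono : ∀ i k, i ≤ k → ∀ j < N i, code (m k) j = code (m i) j := by
    intro i k hik
    induction k, hik using Nat.le_induction with
    | base => exact fun _ _ => rfl
    | succ k hik ih =>
      intro j hj
      rw [hstep k j (hj.trans_le (hlt.monotone hik)), ih j hj]
  -- Since `N` is strictly increasing, `j < N (j + 1)`: cell `j` is settled from stage `j + 1` on.
  let y : ℤ × ℤ → A := fun v => m (Encodable.encode v + 1) v
  have hcy : ∀ j, code y j = code (m (j + 1)) j := by
    intro j
    simp only [code, y, Denumerable.encode_ofNat]
  have hy : ∀ i, ∀ j < N i, code y j = code (m i) j := by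
    intro i j hj
    rw [hcy]
    rcases le_total i (j + 1) with h | h
    · exact hmono i (j + 1) h j hj
    · exact (hmono (j + 1) i h j (Nat.lt_of_succ_le (hlt.le_apply))).symm
  have hyM : y ∈ M := by
    refine hM.prop.2.1.mem_of_tendsto (f := m) (b := Filter.atTop) (tendsto_pi_nhds.2 fun v => ?_)
      (Filter.Eventually.of_forall fun i => (s i).1.2)
    refine tendsto_const_nhds.congr' ?_
    filter_upwards [Filter.eventually_ge_atTop (Encodable.encode v + 1)] with i hi
    have := hy i (Encodable.encode v) (lt_of_lt_of_le hi hlt.le_apply)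
    simpa only [code, Denumerable.ofNat_encode, Encodable.encode_inj] using this
  refine ⟨y, hyM, recursiveIn_of_returns (exists_returns hM hyM (hc y hyM)) (N := N)
    (fun i => ⟨((hN i).1 : Returns _ _ _ _).congr fun j hj => (hy (i + 1) j hj).symm,
      fun t ht => ?_⟩) fun i => (hd i).trans (returns_congr fun j hj => (hy (i + 1) j hj).symm)⟩
  -- An earlier return of `y` would lie within the first `N (i + 1)` cells, where `y` agrees with `m
  -- (i + 1)`, against leastness there.
  by_contra hlt'
  rw [not_le] at hlt'
  exact absurd ((hN i).2 (Returns.congr (fun j hj => hy (i + 1) j (hj.trans hlt')) ht))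
    (not_le.2 hlt')

end PlaneConfig

theorem mainTheorem4 {A : Type*} [Finite A] [Encodable A]
    [TopologicalSpace A] [DiscreteTopology A]
    (X : SymbolicDynamics.FullShift.Subshift A (ℤ × ℤ))
    (hne : X.carrier.Nonempty)
    (hnc : ∀ x ∈ X.carrier, ¬ PlaneConfig.IsComputable x) :
    ∃ x ∈ X.carrier, ∃ y ∈ X.carrier,
      PlaneConfig.degree x ≠ PlaneConfig.degree y ∧
        (PlaneConfig.degree x ≤ PlaneConfig.degree y ∨
          PlaneConfig.degree y ≤ PlaneConfig.degree x) := by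
  obtain ⟨M, hMX, hM⟩ := PlaneConfig.IsInvariantClosed.exists_minimal
    (show PlaneConfig.IsInvariantClosed X.carrier from ⟨hne, X.isClosed, X.mapsTo⟩)
  obtain ⟨x, hx⟩ := hM.prop.1
  obtain ⟨d, hfd, hdf⟩ := Nat.RecursiveIn.exists_strictly_above (PlaneConfig.code x)
  obtain ⟨y, hy, hdy⟩ := PlaneConfig.exists_mem_recursiveIn hM (fun m hm => hnc m (hMX hm)) d
  -- Here `x ≤ d ≤ y`; equal degrees would make `d` recursive in `x`.
  refine ⟨x, hMX hx, y, hMX hy, fun heq => hdf ?_, Or.inl ?_⟩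
  · have hyx := RecursiveIn.iff_nat.1 (PlaneConfig.degree_le_degree_iff.1 heq.ge)
    exact hdy.subst (by rintro _ rfl; exact hyx)
  · exact PlaneConfig.degree_le_degree_iff.2
      (RecursiveIn.iff_nat.2 (hfd.subst (by rintro _ rfl; exact hdy)))
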